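/- Let $\mathbb F$ be a finite field, $\theta$ a field automorphism of $\mathbb F$, and $\mathcal R=\mathbb F[x;\theta]$ the ring of skew polynomials $\sum_i a_i x^i$, with multiplication determined by $xa=\theta(a)x$ for $a\in\mathbb F$. Let $m\ge 0$. For $v\in\mathcal R^m$ put $\deg v=\max_i\deg v_i$ (with $\deg 0=-\infty$); if $v\neq0$, its leading position is the largest $i$ with $\deg v_i=\deg v$. For $V\in\mathcal R^{m\times m}$ let $\deg V$ be the sum of the degrees of its rows. $V$ is in weak Popov form if the leading positions of its non-zero rows are pairwise different, and $V$ has full rank if the left $\mathcal R$-module generated by its rows has rank $m$. There is a unique function $\deg\det:\mathcal R^{m\times m}\to\mathbb Z_{\ge0}\cup\{-\infty\}$ (the degree of the Dieudonné determinant) such that $\deg\det(AA')=\deg\det A+\deg\det A'$ for all $A,A'$, $\deg\det U=0$ for all $U\in \mathrm{GL}_m(\mathcal R)$, and $\deg\det A=\sum_i\deg d_i$ for every diagonal matrix $A$ with diagonal entries $d_i$. Moreover: 1. If $V\in\mathcal R^{m\times m}$ has full rank and is in weak Popov form, then its orthogonality defect $\deg V-\deg\det V$ is zero, i.e. $\deg\det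 V=\deg V$. 2. If $V\in\mathcal R^{m\times m}$ has full rank, then $0\le\deg\det V\le\deg V$. -/

import Mathlib

noncomputable section

/-- The action of `ℕ` (written multiplicatively) on `F` by the powers of the automorphism `θ`,
`n • a = θⁿ a`; it is the datum from which Mathlib builds its skew polynomials. -/
@[reducible] def twistAction {F : Type*} [Field F] (θ : RingAut F) :
    MulSemiringAction (Multiplicative ℕ) F :=
  MulSemiringAction.compHom F (powersHom (RingAut F) θ)

/-- The skew polynomial ring `F[x; θ]`: finite sums `∑ aᵢ xⁱ`, with `x a = θ(a) x`. -/
def SkewPoly {F : Type*} [Field F] (_θ : RingAut F) : Type _ := SkewPolynomial F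

namespace SkewPoly

instance {F : Type*} [Field F] (θ : RingAut F) : Ring (SkewPoly θ) :=
  letI := twistAction θ
  inferInstanceAs (Ring (SkewPolynomial F))

/-- The monomial `a xⁿ`. -/
def monomial {F : Type*} [Field F] (θ : RingAut F) (n : ℕ) (a : F) : SkewPoly θ :=
  SkewPolynomial.monomial n a

/-- The multiplication is the one determined by `x a = θ(a) x`. -/
theorem monomial_mul_monomial {F : Type*} [Field F] (θ : RingAut F) (n k : ℕ) (a b : F) :
    monomial θ n a * monomial θ k b = monomial θ (n + k) (a * (θ ^ n) b) := by
  let _ := twistAction θ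
  exact SkewMonoidAlgebra.single_mul_single

/-- The degree of a skew polynomial, with `deg 0 = ⊥` (that is, `-∞`). -/
def deg {F : Type*} [Field F] {θ : RingAut F} (p : SkewPoly θ) : WithBot ℕ :=
  (SkewPolynomial.support (R := F) p).max

/-- The degree of a vector: the maximal degree of its entries (`⊥` for the zero vector). -/
def vecDeg {F : Type*} [Field F] {θ : RingAut F} {m : ℕ} (v : Fin m → SkewPoly θ) : WithBot ℕ :=
  Finset.univ.sup fun i => deg (v i)

/-- The degree of a matrix: the sum of the degrees of its rows. -/
def matDeg {F : Type*} [Field F] {θ : RingAut F} {n m : ℕ}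
    (V : Matrix (Fin n) (Fin m) (SkewPoly θ)) : WithBot ℕ :=
  ∑ i, vecDeg (V i)

open Classical in
/-- The leading position of a vector: the largest `i` with `deg vᵢ = deg v`. It is only used for
non-zero vectors, and for these it is never `⊥`. -/
def leadingPos {F : Type*} [Field F] {θ : RingAut F} {m : ℕ} (v : Fin m → SkewPoly θ) :
    WithBot (Fin m) :=
  (Finset.univ.filter fun i => deg (v i) = vecDeg v).max

/-- Weak Popov form: the leading positions of the non-zero rows are pairwise different. -/
def IsWeakPopov {F : Type*} [Field F] {θ : RingAut F} {n m : ℕ}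
    (V : Matrix (Fin n) (Fin m) (SkewPoly θ)) : Prop :=
  ∀ i j, V i ≠ 0 → V j ≠ 0 → leadingPos (V i) = leadingPos (V j) → i = j

/-- The rank of a matrix: the rank of the left module spanned by its rows. -/
def rowRank {F : Type*} [Field F] {θ : RingAut F} {n m : ℕ}
    (V : Matrix (Fin n) (Fin m) (SkewPoly θ)) : ℕ :=
  Module.finrank (SkewPoly θ) (Submodule.span (SkewPoly θ) (Set.range fun i => V i))

/-- The three properties that characterise the determinant degree (the degree of the Dieudonné
determinant) among the functions from square skew polynomial matrices to `ℕ ∪ {-∞}`. -/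
structure IsDetDegree {F : Type*} [Field F] {θ : RingAut F} {m : ℕ}
    (D : Matrix (Fin m) (Fin m) (SkewPoly θ) → WithBot ℕ) : Prop where
  map_mul : ∀ A B, D (A * B) = D A + D B
  map_isUnit : ∀ U, IsUnit U → D U = 0
  map_diagonal : ∀ d : Fin m → SkewPoly θ, D (Matrix.diagonal d) = ∑ i, deg (d i)

/-- The determinant degree `deg det`: the function with the properties `IsDetDegree`. That there is
exactly one such function is part of the theorem in which it is used. -/
def degDet {F : Type*} [Field F] {θ : RingAut F} {m : ℕ} :
    Matrix (Fin m) (Fin m) (SkewPoly θ) → WithBot ℕ :=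
  Classical.epsilon fun D => IsDetDegree D

/-- The orthogonality defect `deg V - deg det V`, an integer, for matrices for which both degrees
are different from `-∞`. -/
def orthDefect {F : Type*} [Field F] {θ : RingAut F} {m : ℕ}
    (V : Matrix (Fin m) (Fin m) (SkewPoly θ)) : ℤ :=
  (((matDeg V).unbotD 0 : ℕ) : ℤ) - (((degDet V).unbotD 0 : ℕ) : ℤ)

end SkewPoly

end

/-! Let q = |F|. The determinant degree is realised by counting: if L is the left module generated
by the rows of A, the additive index [R^m : L] is q^(deg det A), where the index 0, which stands for
infinite, matches degree -∞. Division with remainder makes every square matrix a product of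
invertible and diagonal ones (`unitsDiagonals_eq_top`). This gives uniqueness of the degree,
multiplicativity of the index (`rowGroup_index_mul`) and the fact that the index is 0 or a power of
q. Existence follows by taking the exponent. For the degree bounds let d_i be the row degrees of V,
with c ↦ cV injective. The box of vectors of degree below N has q^(mN) elements, and the
combinations cV with deg c_i < N - d_i are q^(mN - ∑ d_i) of them, so L has index at most q^(deg V).
In weak Popov form leading terms cannot cancel (`IsWeakPopov.deg_add_vecDeg_le`), these combinations
are all of L in the box, and equality holds. Full rank enters through
`rowGroup_index_ne_zero_of_rowRank`, which makes the index finite. -/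

noncomputable section

/-! ### Skew polynomials: coefficients, degree, division with remainder, counting. -/

namespace SkewPoly

open Finset

variable {F : Type*} [Field F] {θ : RingAut F}

/-- The coefficient of `xⁿ`, as an additive map. -/
def coeff (n : ℕ) : SkewPoly θ →+ F where
  toFun p := SkewPolynomial.coeff (R := F) p n
  map_zero' := rfl
  map_add' p q := congrFun (congrArg DFunLike.coe (SkewMonoidAlgebra.coeff_add (k := F) p q)) _

theorem ext_coeff {p q : SkewPoly θ} (h : ∀ n, coeff n p = coeff n q) : p = q :=
  SkewMonoidAlgebra.ext (G := Multiplicative ℕ) (k := F) fun n => h (Multiplicative.toAdd n)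

theorem coeff_monomial (n k : ℕ) (a : F) :
    coeff k (monomial θ n a) = if n = k then a else 0 :=
  SkewPolynomial.coeff_monomial (R := F)

theorem monomial_add_induction {P : SkewPoly θ → Prop} (p : SkewPoly θ) (h0 : P 0)
    (hadd : ∀ n a q, P q → P (monomial θ n a + q)) : P p :=
  SkewPolynomial.induction (R := F) (motive := P) p h0 fun n a q _ _ hq => hadd n a q hq

theorem coeff_monomial_mul (n s : ℕ) (a : F) (q : SkewPoly θ) :
    coeff s (monomial θ n a * q) = if n ≤ s then a * (θ ^ n) (coeff (s - n) q) else 0 := by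
  induction q using monomial_add_induction with
  | h0 => simp
  | hadd k b q hq =>
    rw [mul_add, map_add, hq, monomial_mul_monomial, coeff_monomial, map_add, coeff_monomial]
    by_cases h : n ≤ s
    · by_cases h' : n + k = s
      · simp [h, show k = s - n by omega, mul_add]
      · simp [h, h', show k ≠ s - n by omega]
    · simp [h, show n + k ≠ s by omega]

theorem coeff_mul (s : ℕ) (p q : SkewPoly θ) :
    coeff s (p * q) = ∑ i ∈ range (s + 1), coeff i p * (θ ^ i) (coeff (s - i) q) := by
  induction p using monomial_add_induction with
  | h0 => simp
  | hadd n a p hp =>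
    simp only [add_mul, map_add, hp, coeff_monomial_mul, coeff_monomial, sum_add_distrib, ite_mul,
      zero_mul, sum_ite_eq, mem_range, Nat.lt_succ_iff]

theorem deg_lt_iff {p : SkewPoly θ} {n : ℕ} : deg p < n ↔ ∀ k, n ≤ k → coeff k p = 0 := by
  refine (Finset.sup_lt_iff (WithBot.bot_lt_coe n)).trans ?_
  have hmem (k : ℕ) : k ∈ SkewPolynomial.support (R := F) p ↔ coeff k p ≠ 0 :=
    SkewPolynomial.mem_support_iff (R := F)
  simp only [hmem]
  refine ⟨fun h k hk => ?_, fun h k hk => ?_⟩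
  · by_contra hne
    exact absurd (h k hne) (by simpa using hk)
  · by_contra hne
    exact hk (h k (by simpa using hne))

theorem deg_le_iff {p : SkewPoly θ} {n : ℕ} : deg p ≤ n ↔ ∀ k, n < k → coeff k p = 0 := by
  have h : deg p ≤ n ↔ deg p < (n + 1 : ℕ) := by
    cases deg p with
    | bot => simp
    | coe a =>
      exact (Nat.cast_le (α := WithBot ℕ)).trans (Nat.lt_succ_iff.symm.trans Nat.cast_lt.symm)
  rw [h, deg_lt_iff]; rfl

theorem deg_eq_iff {p : SkewPoly θ} {n : ℕ} :
    deg p = n ↔ coeff n p ≠ 0 ∧ ∀ k, n < k → coeff k p = 0 := by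
  rw [← deg_le_iff]
  constructor
  · refine fun h => ⟨fun h0 => ?_, h.le⟩
    refine h.not_lt (deg_lt_iff.2 fun k hk => ?_)
    rcases hk.eq_or_lt with rfl | hk
    · exact h0
    · exact deg_le_iff.1 h.le k hk
  · rintro ⟨h0, hle⟩
    exact hle.eq_of_not_lt fun hlt => h0 (deg_lt_iff.1 hlt n le_rfl)

@[simp] theorem deg_zero : deg (0 : SkewPoly θ) = ⊥ := rfl

@[simp] theorem deg_eq_bot {p : SkewPoly θ} : deg p = ⊥ ↔ p = 0 :=
  Finset.max_eq_bot.trans (SkewPolynomial.support_eq_empty (R := F))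

theorem exists_deg_eq {p : SkewPoly θ} (hp : p ≠ 0) : ∃ n : ℕ, deg p = n :=
  ⟨_, (WithBot.coe_unbot _ (deg_eq_bot.not.2 hp)).symm⟩

/-- The top coefficient of the product is a·θⁿ(b), with a and b the leading coefficients; it is
nonzero because θ is injective. -/
theorem deg_mul (p q : SkewPoly θ) : deg (p * q) = deg p + deg q := by
  rcases eq_or_ne p 0 with rfl | hp
  · simp
  rcases eq_or_ne q 0 with rfl | hq
  · simp
  obtain ⟨n, hn⟩ := exists_deg_eq hp
  obtain ⟨k, hk⟩ := exists_deg_eq hq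
  rw [hn, hk, ← Nat.cast_add, deg_eq_iff]
  obtain ⟨hn0, hn⟩ := deg_eq_iff.1 hn
  obtain ⟨hk0, hk⟩ := deg_eq_iff.1 hk
  refine ⟨?_, fun s hs => ?_⟩
  · rw [coeff_mul, sum_eq_single n]
    · rw [Nat.add_sub_cancel_left]
      exact mul_ne_zero hn0 ((map_ne_zero _).2 hk0)
    · intro i _ hi
      rcases lt_or_gt_of_ne hi with hi | hi
      · rw [hk _ (by omega), map_zero, mul_zero]
      · rw [hn _ hi, zero_mul]
    · simp
  · rw [coeff_mul]
    refine sum_eq_zero fun i _ => ?_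
    rcases le_or_gt i n with hi | hi
    · rw [hk _ (by omega), map_zero, mul_zero]
    · rw [hn _ hi, zero_mul]

theorem deg_neg (p : SkewPoly θ) : deg (-p) = deg p := by
  rcases eq_or_ne p 0 with rfl | hp
  · simp
  obtain ⟨n, hn⟩ := exists_deg_eq hp
  rw [hn, deg_eq_iff]
  simpa using deg_eq_iff.1 hn

theorem deg_add_lt {p q : SkewPoly θ} {e : WithBot ℕ} (hp : deg p < e) (hq : deg q < e) :
    deg (p + q) < e := by
  cases e with
  | bot => simp at hp
  | coe n =>
    refine deg_lt_iff.2 fun k hk => ?_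
    replace hp := deg_lt_iff.1 hp
    replace hq := deg_lt_iff.1 hq
    rw [map_add, hp k hk, hq k hk, add_zero]

theorem deg_sum_lt {ι : Type*} {s : Finset ι} {f : ι → SkewPoly θ} {e : WithBot ℕ} (he : ⊥ < e)
    (h : ∀ i ∈ s, deg (f i) < e) : deg (∑ i ∈ s, f i) < e :=
  sum_induction f (fun p => deg p < e) (fun _ _ => deg_add_lt) (by simpa) h

theorem deg_add_eq_left {p q : SkewPoly θ} (h : deg q < deg p) : deg (p + q) = deg p := by
  have hp : p ≠ 0 := by rintro rfl; simp at h
  obtain ⟨n, hn⟩ := exists_deg_eq hp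
  rw [hn] at h ⊢
  rw [deg_eq_iff] at hn ⊢
  rw [deg_lt_iff] at h
  refine ⟨by simpa [h n le_rfl] using hn.1, fun k hk => ?_⟩
  rw [map_add, hn.2 k hk, h k hk.le, add_zero]

/-- The quotient stands on the left of `b`, as row operations require. -/
theorem exists_deg_sub_mul_lt (a : SkewPoly θ) {b : SkewPoly θ} (hb : b ≠ 0) :
    ∃ q, deg (a - q * b) < deg b := by
  obtain ⟨k, hk⟩ := exists_deg_eq hb
  suffices h : ∀ (e : WithBot ℕ) (a : SkewPoly θ), deg a = e → ∃ q, deg (a - q * b) < deg b from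
    h _ a rfl
  intro e
  induction e using WellFoundedLT.induction with
  | ind e ih =>
    rintro a rfl
    rcases lt_or_ge (deg a) (deg b) with h | h
    · exact ⟨0, by simpa⟩
    have ha : a ≠ 0 := by rintro rfl; simp [hb] at h
    obtain ⟨n, hn⟩ := exists_deg_eq ha
    rw [hn, hk] at h
    have hkn : k ≤ n := by simpa using h
    -- Moving x^(n-k) past the leading coefficient of `b` twists it by θ^(n-k), so the twisted
    -- coefficient is the one to divide by.
    set c : SkewPoly θ := monomial θ (n - k) (coeff n a / (θ ^ (n - k)) (coeff k b)) with hc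
    obtain ⟨hn0, hn'⟩ := deg_eq_iff.1 hn
    obtain ⟨hk0, hk'⟩ := deg_eq_iff.1 hk
    have hlt : deg (a - c * b) < deg a := by
      rw [hn]
      refine deg_lt_iff.2 fun s hs => ?_
      rw [map_sub, hc, coeff_monomial_mul, if_pos (by omega)]
      rcases hs.eq_or_lt with rfl | hs
      · rw [show n - (n - k) = k by omega, div_mul_cancel₀ _ ((map_ne_zero _).2 hk0), sub_self]
      · rw [hn' s hs, hk' (s - (n - k)) (by omega)]; simp
    obtain ⟨q, hq⟩ := ih _ hlt _ rfl
    exact ⟨q + c, by rwa [add_mul, add_comm, ← sub_sub]⟩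

/-- The additive group of skew polynomials of degree less than `n`. -/
def degLT (θ : RingAut F) (n : ℕ) : AddSubgroup (SkewPoly θ) where
  carrier := {p | deg p < n}
  zero_mem' := by simp
  add_mem' := deg_add_lt
  neg_mem' := by simp [deg_neg]

theorem mem_degLT {n : ℕ} {p : SkewPoly θ} : p ∈ degLT θ n ↔ deg p < n := Iff.rfl

/-- A skew polynomial of degree less than `n` is determined by its first `n` coefficients. -/
def degLTEquiv (θ : RingAut F) (n : ℕ) : degLT θ n ≃ (Fin n → F) where
  toFun p i := coeff i.1 p.1
  invFun f := ⟨∑ i : Fin n, monomial θ i.1 (f i), mem_degLT.2 <| deg_lt_iff.2 fun k hk => by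
    rw [map_sum]
    exact sum_eq_zero fun i _ => by rw [coeff_monomial, if_neg (by omega)]⟩
  left_inv p := by
    refine Subtype.ext (ext_coeff fun k => ?_)
    simp only [map_sum, coeff_monomial]
    rcases lt_or_ge k n with hk | hk
    · rw [sum_eq_single ⟨k, hk⟩]
      · simp
      · exact fun i _ hi => if_neg fun h => hi (Fin.ext h)
      · simp
    · rw [deg_lt_iff.1 p.2 k hk]
      exact sum_eq_zero fun i _ => if_neg (by omega)
  right_inv f := by
    ext k
    simp only [map_sum, coeff_monomial]
    rw [sum_eq_single k]
    · simp
    · exact fun i _ hi => if_neg fun h => hi (Fin.ext h)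
    · simp

theorem natCard_degLT [Finite F] (n : ℕ) : Nat.card (degLT θ n) = Nat.card F ^ n := by
  simp [Nat.card_congr (degLTEquiv θ n), Nat.card_fun]

instance [Finite F] (n : ℕ) : Finite (degLT θ n) := Finite.of_equiv _ (degLTEquiv θ n).symm

instance : Nontrivial (SkewPoly θ) :=
  ⟨⟨monomial θ 0 1, 0, fun h => by simpa [coeff_monomial] using congrArg (coeff 0) h⟩⟩

instance : NoZeroDivisors (SkewPoly θ) where
  eq_zero_or_eq_zero_of_mul_eq_zero {a b} h := by
    simpa [deg_mul, WithBot.add_eq_bot] using congrArg deg h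

end SkewPoly

end

/-! ### Generation of all matrices by invertible and diagonal ones. -/

namespace Matrix

open Finset

variable {R : Type*} [Ring R]

/-- The submonoid generated by the invertible and the diagonal matrices. -/
def unitsDiagonals (R : Type*) [Ring R] (m : ℕ) : Submonoid (Matrix (Fin m) (Fin m) R) :=
  Submonoid.closure ({U | IsUnit U} ∪ Set.range diagonal)

/-- The rank-one part squares to zero, so changing its sign gives the inverse. -/
theorem isUnit_one_add_vecMulVec {n : Type*} [Fintype n] [DecidableEq n] (v w : n → R)
    (h : w ⬝ᵥ v = 0) : IsUnit (1 + vecMulVec v w) := by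
  have h2 : vecMulVec v w * vecMulVec v w = 0 := by
    rw [vecMulVec_mul_vecMulVec, h, zero_smul, vecMulVec_zero]
  refine ⟨⟨1 + vecMulVec v w, 1 - vecMulVec v w, ?_, ?_⟩, rfl⟩
  · simp [add_mul, mul_sub, h2]
  · simp [sub_mul, mul_add, h2]

/-- The block diagonal matrix `diag(1, C)`. -/
def oneBlock (m : ℕ) : Matrix (Fin m) (Fin m) R →* Matrix (Fin (m + 1)) (Fin (m + 1)) R where
  toFun C := of (Fin.cons (Fin.cons 1 0) fun i => Fin.cons 0 (C i))
  map_one' := by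
    ext i j
    refine Fin.cases ?_ (fun i => ?_) i <;> refine Fin.cases ?_ (fun j => ?_) j <;>
      simp [one_apply, Fin.succ_ne_zero, (Fin.succ_ne_zero _).symm]
  map_mul' A B := by
    ext i j
    refine Fin.cases ?_ (fun i => ?_) i <;> refine Fin.cases ?_ (fun j => ?_) j <;>
      simp [mul_apply, Fin.sum_univ_succ]

theorem oneBlock_mem {m : ℕ} {C : Matrix (Fin m) (Fin m) R} (hC : C ∈ unitsDiagonals R m) :
    oneBlock m C ∈ unitsDiagonals R (m + 1) := by
  refine (Submonoid.closure_le (S := (unitsDiagonals R (m + 1)).comap (oneBlock m))).2 ?_ hC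
  rintro _ (hU | ⟨d, rfl⟩)
  · exact Submonoid.subset_closure (Or.inl (hU.map (oneBlock m)))
  · refine Submonoid.subset_closure (Or.inr ⟨Fin.cons 1 d, ?_⟩)
    ext i j
    refine Fin.cases ?_ (fun i => ?_) i <;> refine Fin.cases ?_ (fun j => ?_) j <;>
      simp [oneBlock, diagonal_apply, Fin.succ_ne_zero, (Fin.succ_ne_zero _).symm]

theorem mem_unitsDiagonals_of_isUnit_mul {m : ℕ} {U A : Matrix (Fin m) (Fin m) R} (hU : IsUnit U)
    (h : U * A ∈ unitsDiagonals R m) : A ∈ unitsDiagonals R m := by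
  obtain ⟨u, rfl⟩ := hU
  rw [← u.inv_mul_cancel_left A]
  exact mul_mem (Submonoid.subset_closure (Or.inl u⁻¹.isUnit)) h

/-- A matrix whose first column vanishes below the diagonal is a product of a block matrix
`diag(1, C)`, an invertible matrix and a diagonal matrix. -/
theorem mem_unitsDiagonals_of_first_col {m : ℕ} (ih : unitsDiagonals R m = ⊤)
    (A : Matrix (Fin (m + 1)) (Fin (m + 1)) R) (hA : ∀ i : Fin m, A i.succ 0 = 0) :
    A ∈ unitsDiagonals R (m + 1) := by
  -- The diagonal factor on the right scales only the first column, so the corner entry, which need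
  -- not be invertible, stays out of the other two factors.
  have key : A = oneBlock m (of fun i j => A i.succ j.succ) *
      (1 + vecMulVec (Fin.cons 1 0) (Fin.cons 0 fun j => A 0 j.succ)) *
      diagonal (Fin.cons (A 0 0) 1) := by
    ext i j
    refine Fin.cases ?_ (fun i => ?_) i <;> refine Fin.cases ?_ (fun j => ?_) j <;>
      simp [mul_apply, Fin.sum_univ_succ, oneBlock, vecMulVec_apply, one_apply, diagonal_apply,
        Fin.succ_ne_zero, (Fin.succ_ne_zero _).symm, hA]
  rw [key]
  refine mul_mem (mul_mem (oneBlock_mem (ih ▸ Submonoid.mem_top _)) ?_) ?_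
  · refine Submonoid.subset_closure (Or.inl (isUnit_one_add_vecMulVec _ _ ?_))
    simp [dotProduct, Fin.sum_univ_succ]
  · exact Submonoid.subset_closure (Or.inr ⟨_, rfl⟩)

/-- Among the nonzero entries of all vectors `U *ᵥ v` one of minimal `δ` is moved to position 0.
Reducing the other entries modulo it leaves zeros, since a nonzero remainder would contradict
minimality. -/
theorem exists_isUnit_mulVec_succ_eq_zero (δ : R → WithBot ℕ)
    (hδ : ∀ a b : R, b ≠ 0 → ∃ q, δ (a - q * b) < δ b) {m : ℕ} (v : Fin (m + 1) → R) :
    ∃ U : Matrix (Fin (m + 1)) (Fin (m + 1)) R, IsUnit U ∧ ∀ i : Fin m, (U *ᵥ v) i.succ = 0 := by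
  by_cases hv : v = 0
  · exact ⟨1, isUnit_one, by simp [hv]⟩
  obtain ⟨i₀, hi₀⟩ := Function.ne_iff.1 hv
  let S : Set R := {a | a ≠ 0 ∧ ∃ U : Matrix (Fin (m + 1)) (Fin (m + 1)) R,
    IsUnit U ∧ ∃ i, (U *ᵥ v) i = a}
  obtain ⟨a, ⟨ha, U, hU, i, hi⟩, hmin⟩ := WellFounded.has_min (InvImage.wf δ wellFounded_lt) S
    ⟨v i₀, hi₀, 1, isUnit_one, i₀, by simp⟩
  let P : Matrix (Fin (m + 1)) (Fin (m + 1)) R := (Equiv.swap 0 i).permMatrix R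
  have hP : IsUnit P := by
    have hPP : P * P = 1 := by
      rw [← permMatrix_mul]; simp
    exact ⟨⟨P, P, hPP, hPP⟩, rfl⟩
  set w := (P * U) *ᵥ v with hw
  have hw0 : w 0 = a := by
    rw [hw, ← mulVec_mulVec]
    simpa [P, mulVec, dotProduct, Equiv.Perm.permMatrix, PEquiv.toMatrix_apply] using hi
  choose q hq using fun b => hδ b a ha
  let T : Matrix (Fin (m + 1)) (Fin (m + 1)) R :=
    1 + vecMulVec (Fin.cons 0 fun j => -q (w j.succ)) (Pi.single 0 1)
  have hT : IsUnit T := isUnit_one_add_vecMulVec _ _ (by simp)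
  refine ⟨T * (P * U), hT.mul (hP.mul hU), fun j => ?_⟩
  have hj : ((T * (P * U)) *ᵥ v) j.succ = w j.succ - q (w j.succ) * a := by
    rw [← mulVec_mulVec, ← hw, add_mulVec, vecMulVec_mulVec]
    simp [hw0, sub_eq_add_neg]
  by_contra hne
  exact hmin _ ⟨hne, _, hT.mul (hP.mul hU), j.succ, rfl⟩ (by rw [InvImage, hj]; exact hq _)

/-- Over a left Euclidean ring the invertible and the diagonal matrices generate all square
matrices. -/
theorem unitsDiagonals_eq_top (δ : R → WithBot ℕ)
    (hδ : ∀ a b : R, b ≠ 0 → ∃ q, δ (a - q * b) < δ b) (m : ℕ) : unitsDiagonals R m = ⊤ := by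
  induction m with
  | zero => exact eq_top_iff.2 fun A _ => Subsingleton.elim 1 A ▸ one_mem _
  | succ m ih =>
    refine eq_top_iff.2 fun A _ => ?_
    obtain ⟨U, hU, h⟩ := exists_isUnit_mulVec_succ_eq_zero δ hδ fun i => A i 0
    exact mem_unitsDiagonals_of_isUnit_mul hU (mem_unitsDiagonals_of_first_col ih _ h)

end Matrix

/-! ### Computing an index along an exhausting chain of finite subgroups. -/

namespace AddSubgroup

/-- If the relative indices of `H` in an exhausting chain of finite subgroups are bounded, then `H`
has finite index, and the relative indices eventually agree with it. -/
theorem index_ne_zero_and_relIndex_eq_of_bounded {G : Type*} [AddCommGroup G] (H : AddSubgroup G)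
    {W : ℕ → AddSubgroup G} [∀ n, Finite (W n)] (hmono : Monotone W) (hW : ∀ g, ∃ n, g ∈ W n)
    {B n₀ : ℕ} (hB : ∀ n, n₀ ≤ n → H.relIndex (W n) ≤ B) :
    H.index ≠ 0 ∧ ∃ n₁, ∀ n, n₁ ≤ n → H.relIndex (W n) = H.index := by
  -- The relative index counts the cosets of `H` that meet `W n`.
  have hrel (n : ℕ) : H.relIndex (W n) = Nat.card ((W n).map (QuotientAddGroup.mk' H)) := by
    rw [← relIndex_ker, QuotientAddGroup.ker_mk']
  choose ν hν using hW
  -- Finitely many cosets have representatives in a common `W n`.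
  have key (t : Finset (G ⧸ H)) : ∃ n₁, ∀ n, n₁ ≤ n → t.card ≤ H.relIndex (W n) := by
    refine ⟨t.sup fun x => ν x.out, fun n hn => ?_⟩
    have : Finite ((W n).map (QuotientAddGroup.mk' H)) :=
      Set.Finite.image (QuotientAddGroup.mk' H) (Set.toFinite (W n : Set G))
    rw [hrel, ← Set.ncard_coe_finset]
    refine Set.ncard_le_ncard (t := ((W n).map (QuotientAddGroup.mk' H) : Set (G ⧸ H)))
      (fun x hx => ?_) (Set.toFinite _)
    exact ⟨x.out, hmono ((Finset.le_sup (f := fun x : G ⧸ H => ν x.out) hx).trans hn) (hν _),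
      QuotientAddGroup.out_eq' x⟩
  have hfin : Finite (G ⧸ H) := by
    by_contra hinf
    rw [not_finite_iff_infinite] at hinf
    obtain ⟨t, ht⟩ := Infinite.exists_subset_card_eq (G ⧸ H) (B + 1)
    obtain ⟨n₁, h₁⟩ := key t
    have h := (h₁ (max n₀ n₁) (le_max_right _ _)).trans (hB (max n₀ n₁) (le_max_left _ _))
    omega
  have h0 : H.index ≠ 0 := index_ne_zero_of_finite (hH := hfin)
  refine ⟨h0, ?_⟩
  have := Fintype.ofFinite (G ⧸ H)
  obtain ⟨n₁, h₁⟩ := key Finset.univ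
  refine ⟨n₁, fun n hn => le_antisymm ?_ ?_⟩
  · exact Nat.le_of_dvd (Nat.pos_of_ne_zero h0) (relIndex_dvd_index_of_normal _ _)
  · simpa [index_eq_card, Nat.card_eq_fintype_card] using h₁ n hn

end AddSubgroup

/-! ### Row degrees, weak Popov form and the index of the row module. -/

noncomputable section

namespace SkewPoly

open Finset Matrix

variable {F : Type*} [Field F] {θ : RingAut F} {m : ℕ}

theorem deg_le_vecDeg (v : Fin m → SkewPoly θ) (i : Fin m) : deg (v i) ≤ vecDeg v :=
  le_sup (f := fun i => deg (v i)) (mem_univ i)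

theorem vecDeg_eq_bot {v : Fin m → SkewPoly θ} : vecDeg v = ⊥ ↔ v = 0 := by
  simp [vecDeg, Finset.sup_eq_bot_iff, funext_iff]

theorem exists_vecDeg_eq {v : Fin m → SkewPoly θ} (hv : v ≠ 0) : ∃ d : ℕ, vecDeg v = d :=
  ⟨_, (WithBot.coe_unbot _ (vecDeg_eq_bot.not.2 hv)).symm⟩

theorem exists_leadingPos_eq {v : Fin m → SkewPoly θ} (hv : v ≠ 0) :
    ∃ j : Fin m, leadingPos v = j ∧ deg (v j) = vecDeg v ∧ ∀ k, j < k → deg (v k) < vecDeg v := by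
  classical
  obtain ⟨i, -⟩ := Function.ne_iff.1 hv
  obtain ⟨i, -, hi⟩ := exists_mem_eq_sup univ ⟨i, mem_univ i⟩ fun i => deg (v i)
  obtain ⟨j, hj⟩ := max_of_mem (s := univ.filter fun i => deg (v i) = vecDeg v) (a := i)
    (mem_filter.2 ⟨mem_univ i, hi.symm⟩)
  refine ⟨j, by rw [leadingPos]; convert hj, (mem_filter.1 (mem_of_max hj)).2, fun k hk => ?_⟩
  refine (deg_le_vecDeg v k).lt_of_ne fun h => ?_
  exact (le_max_of_eq (mem_filter.2 ⟨mem_univ k, h⟩) hj).not_gt hk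

/-- The predictable degree property of matrices in weak Popov form. -/
theorem IsWeakPopov.deg_add_vecDeg_le {V : Matrix (Fin m) (Fin m) (SkewPoly θ)}
    (hV : IsWeakPopov V) (h0 : ∀ i, V i ≠ 0) (c : Fin m → SkewPoly θ) (i : Fin m) :
    deg (c i) + vecDeg (V i) ≤ vecDeg (c ᵥ* V) := by
  -- Ties in degree are broken by the leading position: a row tied with row `l` has its leading
  -- position strictly before that of `l`. Hence in the column of that position the `l`-th term
  -- strictly dominates.
  obtain ⟨l, -, hl⟩ := exists_max_image univ
    (fun i => toLex (deg (c i) + vecDeg (V i), leadingPos (V i))) ⟨i, mem_univ i⟩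
  have hmax (k : Fin m) : deg (c k) + vecDeg (V k) ≤ deg (c l) + vecDeg (V l) := by
    rcases Prod.Lex.toLex_le_toLex.1 (hl k (mem_univ k)) with h | h
    exacts [h.le, h.1.le]
  refine (hmax i).trans ?_
  rcases eq_or_ne (c l) 0 with hc | hc
  · simp [hc]
  obtain ⟨a, ha⟩ := exists_deg_eq hc
  obtain ⟨d, hd⟩ := exists_vecDeg_eq (h0 l)
  obtain ⟨j, hj, hjd, -⟩ := exists_leadingPos_eq (h0 l)
  refine le_trans (le_of_eq ?_) (deg_le_vecDeg _ j)
  have hsum : (c ᵥ* V) j = c l * V l j + ∑ k ∈ univ.erase l, c k * V k j :=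
    (add_sum_erase univ (fun k => c k * V k j) (mem_univ l)).symm
  have hlj : deg (c l * V l j) = deg (c l) + vecDeg (V l) := by rw [deg_mul, hjd]
  rw [hsum, deg_add_eq_left, hlj]
  rw [hlj]
  refine deg_sum_lt (by rw [ha, hd, ← Nat.cast_add]; exact WithBot.bot_lt_coe _) fun k hk => ?_
  rw [deg_mul]
  rcases Prod.Lex.toLex_le_toLex.1 (hl k (mem_univ k)) with h | ⟨h, hle⟩
  · exact (add_le_add_right (deg_le_vecDeg _ _) _).trans_lt h
  · obtain ⟨p, hp, -, hlt⟩ := exists_leadingPos_eq (h0 k)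
    have hpj : p < j := by
      refine WithBot.coe_lt_coe.1 (hp ▸ hj ▸ lt_of_le_of_ne hle fun he => ?_)
      exact (mem_erase.1 hk).1 (hV k l (h0 k) (h0 l) he)
    simp only at h
    rw [← h]
    -- Strictness needs `deg (c k) ≠ ⊥`; otherwise the tie would make the maximal degree `⊥`.
    refine WithBot.add_lt_add_left (fun hbot => ?_) (hlt j hpj)
    rw [hbot, ha, hd, WithBot.bot_add, ← Nat.cast_add] at h
    exact WithBot.bot_ne_coe h

theorem IsWeakPopov.vecMul_injective {V : Matrix (Fin m) (Fin m) (SkewPoly θ)}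
    (hV : IsWeakPopov V) (h0 : ∀ i, V i ≠ 0) : Function.Injective (· ᵥ* V) := by
  refine (injective_iff_map_eq_zero V.vecMulLinear).2 fun c hc => funext fun i => ?_
  have h := hV.deg_add_vecDeg_le h0 c i
  rw [show c ᵥ* V = 0 from hc, vecDeg_eq_bot.2 rfl, le_bot_iff, WithBot.add_eq_bot, deg_eq_bot, vecDeg_eq_bot] at h
  exact h.resolve_right (h0 i)

/-- The vectors whose `i`-th entry has degree less than `n i`. -/
def vecDegLT (θ : RingAut F) (n : Fin m → ℕ) : AddSubgroup (Fin m → SkewPoly θ) :=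
  AddSubgroup.pi Set.univ fun i => degLT θ (n i)

theorem mem_vecDegLT {n : Fin m → ℕ} {v : Fin m → SkewPoly θ} :
    v ∈ vecDegLT θ n ↔ ∀ i, deg (v i) < n i := by
  simp [vecDegLT, AddSubgroup.mem_pi, mem_degLT]

/-- Membership in `vecDegLT` is entrywise. -/
def vecDegLTEquiv (θ : RingAut F) (n : Fin m → ℕ) : vecDegLT θ n ≃ ∀ i, degLT θ (n i) where
  toFun v i := ⟨v.1 i, mem_vecDegLT.1 v.2 i⟩
  invFun w := ⟨fun i => (w i).1, mem_vecDegLT.2 fun i => (w i).2⟩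

instance [Finite F] (n : Fin m → ℕ) : Finite (vecDegLT θ n) :=
  Finite.of_equiv _ (vecDegLTEquiv θ n).symm

theorem natCard_vecDegLT [Finite F] (n : Fin m → ℕ) :
    Nat.card (vecDegLT θ n) = Nat.card F ^ ∑ i, n i := by
  rw [Nat.card_congr (vecDegLTEquiv θ n), Nat.card_pi]
  simp [natCard_degLT, prod_pow_eq_pow_sum]

/-- The row module of a matrix, as an additive group. -/
def rowGroup (V : Matrix (Fin m) (Fin m) (SkewPoly θ)) : AddSubgroup (Fin m → SkewPoly θ) :=
  V.vecMulLinear.toAddMonoidHom.range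

/-- The truncated subtraction is harmless: if `N ≤ d i`, the bound forces `c i = 0`. -/
theorem vecMul_mem_vecDegLT {V : Matrix (Fin m) (Fin m) (SkewPoly θ)} {d : Fin m → ℕ}
    (hd : ∀ i, vecDeg (V i) = d i) {N : ℕ} {c : Fin m → SkewPoly θ}
    (hc : c ∈ vecDegLT θ fun i => N - d i) : c ᵥ* V ∈ vecDegLT θ fun _ : Fin m => N := by
  refine mem_vecDegLT.2 fun j => deg_sum_lt (WithBot.bot_lt_coe N) fun i _ => ?_
  have hi := mem_vecDegLT.1 hc i
  rw [deg_mul]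
  rcases eq_or_ne (c i) 0 with h | h
  · simp [h]
  obtain ⟨a, ha⟩ := exists_deg_eq h
  refine (add_le_add_right ((deg_le_vecDeg (V i) j).trans (hd i).le) _).trans_lt ?_
  rw [ha] at hi ⊢
  have hi : a < N - d i := Nat.cast_lt.1 hi
  rw [← Nat.cast_add]
  exact Nat.cast_lt.2 (by omega)

/-- By injectivity the image has q^(∑ (N - d_i)) elements inside a box of q^(mN); the quotient no
longer depends on `N`. -/
theorem relIndex_map_vecDegLT [Finite F] {V : Matrix (Fin m) (Fin m) (SkewPoly θ)} {d : Fin m → ℕ}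
    (hd : ∀ i, vecDeg (V i) = d i) (hV : Function.Injective (· ᵥ* V)) {N : ℕ} (hN : ∀ i, d i ≤ N) :
    ((vecDegLT θ fun i => N - d i).map V.vecMulLinear.toAddMonoidHom).relIndex
      (vecDegLT θ fun _ : Fin m => N) = Nat.card F ^ ∑ i, d i := by
  set K := (vecDegLT θ fun i => N - d i).map V.vecMulLinear.toAddMonoidHom
  have hK : K ≤ vecDegLT θ fun _ : Fin m => N := by
    rintro _ ⟨c, hc, rfl⟩
    exact vecMul_mem_vecDegLT hd hc
  have hcard : Nat.card K = Nat.card F ^ ∑ i, (N - d i) := by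
    rw [← natCard_vecDegLT (θ := θ)]
    exact (Nat.card_congr (Equiv.Set.image _ _ hV)).symm
  -- Relative to `⊥` the index is the cardinality, so the tower law is the counting identity.
  have h := AddSubgroup.relIndex_mul_relIndex ⊥ K _ bot_le hK
  rw [AddSubgroup.relIndex_bot_left, AddSubgroup.relIndex_bot_left, hcard, natCard_vecDegLT,
    show ∑ _i : Fin m, N = ∑ i, (N - d i) + ∑ i, d i by
      rw [← sum_add_distrib]; exact sum_congr rfl fun i _ => (Nat.sub_add_cancel (hN i)).symm,
    pow_add] at h
  exact Nat.eq_of_mul_eq_mul_left (pow_pos Nat.card_pos _) h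

/-- The row module contains the image just counted, and a larger subgroup has smaller index. -/
theorem rowGroup_relIndex_le [Finite F] {V : Matrix (Fin m) (Fin m) (SkewPoly θ)} {d : Fin m → ℕ}
    (hd : ∀ i, vecDeg (V i) = d i) (hV : Function.Injective (· ᵥ* V)) {N : ℕ} (hN : ∀ i, d i ≤ N) :
    (rowGroup V).relIndex (vecDegLT θ fun _ : Fin m => N) ≤ Nat.card F ^ ∑ i, d i := by
  rw [← relIndex_map_vecDegLT hd hV hN]
  refine Nat.le_of_dvd ?_ (AddSubgroup.relIndex_dvd_of_le_left _ ?_)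
  · rw [relIndex_map_vecDegLT hd hV hN]
    exact pow_pos Nat.card_pos _
  · rintro _ ⟨c, -, rfl⟩
    exact ⟨c, rfl⟩

/-- By the predictable degree property, a row combination of degree below `N` has coefficients of
degree below `N - d i`, so the image just counted is the whole intersection with the box. -/
theorem IsWeakPopov.rowGroup_relIndex_eq [Finite F] {V : Matrix (Fin m) (Fin m) (SkewPoly θ)}
    (hW : IsWeakPopov V) (h0 : ∀ i, V i ≠ 0) {d : Fin m → ℕ} (hd : ∀ i, vecDeg (V i) = d i)
    {N : ℕ} (hN : ∀ i, d i ≤ N) :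
    (rowGroup V).relIndex (vecDegLT θ fun _ : Fin m => N) = Nat.card F ^ ∑ i, d i := by
  rw [← relIndex_map_vecDegLT hd (hW.vecMul_injective h0) hN, ← AddSubgroup.inf_relIndex_right]
  congr 1
  refine le_antisymm ?_ ?_
  · rintro _ ⟨⟨c, rfl⟩, hc⟩
    refine ⟨c, mem_vecDegLT.2 fun i => ?_, rfl⟩
    have h : deg (c i) + d i < N := by
      rw [← hd]
      refine (hW.deg_add_vecDeg_le h0 c i).trans_lt ?_
      exact (Finset.sup_lt_iff (WithBot.bot_lt_coe N)).2 fun j _ => mem_vecDegLT.1 hc j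
    rcases eq_or_ne (c i) 0 with hci | hci
    · simp [hci]
    obtain ⟨a, ha⟩ := exists_deg_eq hci
    rw [ha] at h ⊢
    rw [← Nat.cast_add] at h
    have h : a + d i < N := Nat.cast_lt.1 h
    exact Nat.cast_lt.2 (by omega)
  · rintro _ ⟨c, hc, rfl⟩
    exact ⟨⟨c, rfl⟩, vecMul_mem_vecDegLT hd hc⟩

theorem vecDegLT_const_mono : Monotone fun N : ℕ => vecDegLT θ fun _ : Fin m => N :=
  fun _ _ h _ hv => mem_vecDegLT.2 fun i => (mem_vecDegLT.1 hv i).trans_le (Nat.cast_le.2 h)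

theorem exists_mem_vecDegLT_const (v : Fin m → SkewPoly θ) :
    ∃ N : ℕ, v ∈ vecDegLT θ fun _ : Fin m => N := by
  rcases eq_or_ne v 0 with rfl | hv
  · exact ⟨0, zero_mem _⟩
  · obtain ⟨d, hd⟩ := exists_vecDeg_eq hv
    refine ⟨d + 1, mem_vecDegLT.2 fun i => ?_⟩
    exact (deg_le_vecDeg v i).trans_lt (hd ▸ Nat.cast_lt.2 d.lt_succ_self)

theorem rowGroup_index_ne_zero_and_le [Finite F] {V : Matrix (Fin m) (Fin m) (SkewPoly θ)}
    {d : Fin m → ℕ} (hd : ∀ i, vecDeg (V i) = d i) (hV : Function.Injective (· ᵥ* V)) :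
    (rowGroup V).index ≠ 0 ∧ (rowGroup V).index ≤ Nat.card F ^ ∑ i, d i := by
  have hN {N : ℕ} (h : univ.sup d ≤ N) (i : Fin m) : d i ≤ N := (le_sup (mem_univ i)).trans h
  obtain ⟨h0, n₁, h₁⟩ := (rowGroup V).index_ne_zero_and_relIndex_eq_of_bounded vecDegLT_const_mono
    exists_mem_vecDegLT_const fun N h => rowGroup_relIndex_le hd hV (hN h)
  refine ⟨h0, ?_⟩
  rw [← h₁ (max n₁ (univ.sup d)) (le_max_left _ _)]
  exact rowGroup_relIndex_le hd hV (hN (le_max_right _ _))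

theorem IsWeakPopov.rowGroup_index_eq [Finite F] {V : Matrix (Fin m) (Fin m) (SkewPoly θ)}
    (hW : IsWeakPopov V) (h0 : ∀ i, V i ≠ 0) {d : Fin m → ℕ} (hd : ∀ i, vecDeg (V i) = d i) :
    (rowGroup V).index = Nat.card F ^ ∑ i, d i := by
  have hN {N : ℕ} (h : univ.sup d ≤ N) (i : Fin m) : d i ≤ N := (le_sup (mem_univ i)).trans h
  obtain ⟨-, n₁, h₁⟩ := (rowGroup V).index_ne_zero_and_relIndex_eq_of_bounded vecDegLT_const_mono
    exists_mem_vecDegLT_const fun N h => (hW.rowGroup_relIndex_eq h0 hd (hN h)).le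
  rw [← h₁ (max n₁ (univ.sup d)) (le_max_left _ _)]
  exact hW.rowGroup_relIndex_eq h0 hd (hN (le_max_right _ _))

end SkewPoly

end

/-! ### The index as determinant degree: multiplicativity, uniqueness, full rank. -/

noncomputable section

namespace SkewPoly

open Finset Matrix

variable {F : Type*} [Field F] {θ : RingAut F} {m : ℕ}

/-- The power `qᵉ`, with `q^(-∞) = 0`. -/
def powBot (q : ℕ) : WithBot ℕ → ℕ :=
  WithBot.recBotCoe 0 (q ^ ·)

@[simp] theorem powBot_bot (q : ℕ) : powBot q ⊥ = 0 := rfl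

@[simp] theorem powBot_natCast (q n : ℕ) : powBot q n = q ^ n := rfl

theorem powBot_zero (q : ℕ) : powBot q 0 = 1 := pow_zero q

theorem powBot_add (q : ℕ) (a b : WithBot ℕ) : powBot q (a + b) = powBot q a * powBot q b := by
  cases a with
  | bot => simp
  | coe a =>
    cases b with
    | bot => simp
    | coe b => exact pow_add q a b

theorem powBot_sum {ι : Type*} (q : ℕ) (s : Finset ι) (f : ι → WithBot ℕ) :
    powBot q (∑ i ∈ s, f i) = ∏ i ∈ s, powBot q (f i) := by
  classical
  induction s using Finset.induction_on with
  | empty => exact powBot_zero q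
  | insert a s ha ih => rw [sum_insert ha, prod_insert ha, powBot_add, ih]

theorem powBot_le_iff {q : ℕ} (hq : 1 < q) {a b : WithBot ℕ} :
    powBot q a ≤ powBot q b ↔ a ≤ b := by
  cases a with
  | bot => simp
  | coe a =>
    cases b with
    | bot =>
      have h : q ^ a ≠ 0 := (pow_pos (by omega) a).ne'
      exact ⟨fun hle => (h (Nat.le_zero.1 hle)).elim, fun hle => (WithBot.not_coe_le_bot a hle).elim⟩
    | coe b => exact (Nat.pow_le_pow_iff_right hq).trans WithBot.coe_le_coe.symm

theorem powBot_injective {q : ℕ} (hq : 1 < q) : Function.Injective (powBot q) := fun _ _ h =>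
  le_antisymm ((powBot_le_iff hq).1 h.le) ((powBot_le_iff hq).1 h.ge)

theorem matDeg_eq {V : Matrix (Fin m) (Fin m) (SkewPoly θ)} {d : Fin m → ℕ}
    (hd : ∀ i, vecDeg (V i) = d i) : matDeg V = (∑ i, d i : ℕ) := by
  simp [matDeg, hd]

theorem exists_vecDeg_row_eq {V : Matrix (Fin m) (Fin m) (SkewPoly θ)} (h0 : ∀ i, V i ≠ 0) :
    ∃ d : Fin m → ℕ, ∀ i, vecDeg (V i) = d i :=
  ⟨_, fun i => (exists_vecDeg_eq (h0 i)).choose_spec⟩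

theorem row_ne_zero_of_vecMul_injective {V : Matrix (Fin m) (Fin m) (SkewPoly θ)}
    (hV : Function.Injective (· ᵥ* V)) (i : Fin m) : V i ≠ 0 := by
  intro h
  have h1 : Pi.single i 1 = (0 : Fin m → SkewPoly θ) := hV (by simp [row, h])
  simpa using congrFun h1 i

theorem rowGroup_mul (A B : Matrix (Fin m) (Fin m) (SkewPoly θ)) :
    rowGroup (A * B) = (rowGroup A).map B.vecMulLinear.toAddMonoidHom := by
  rw [rowGroup, rowGroup, AddMonoidHom.map_range]
  congr 1
  exact AddMonoidHom.ext fun v => (vecMul_vecMul v A B).symm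

theorem rowGroup_index_mul_of_injective (A : Matrix (Fin m) (Fin m) (SkewPoly θ))
    {B : Matrix (Fin m) (Fin m) (SkewPoly θ)} (hB : Function.Injective (· ᵥ* B)) :
    (rowGroup (A * B)).index = (rowGroup A).index * (rowGroup B).index := by
  rw [rowGroup_mul]
  exact AddSubgroup.index_map_of_injective _ hB

/-- The row module lies in the kernel of a coordinate map onto the infinite ring of skew
polynomials, so its index is infinite. -/
theorem rowGroup_index_eq_zero_of_column {V : Matrix (Fin m) (Fin m) (SkewPoly θ)} {j : Fin m}
    (hV : ∀ i, V i j = 0) : (rowGroup V).index = 0 := by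
  have hle : rowGroup V ≤ (Pi.evalAddMonoidHom (fun _ : Fin m => SkewPoly θ) j).ker := by
    rintro _ ⟨c, rfl⟩
    exact show ∑ i, c i * V i j = 0 from sum_eq_zero fun i _ => by rw [hV, mul_zero]
  have hinf : Infinite (SkewPoly θ) := by
    refine Infinite.of_injective (fun n : ℕ => monomial θ n 1) fun n k h => ?_
    have h := congrArg (coeff k) h
    simpa [coeff_monomial] using h
  have h0 : (Pi.evalAddMonoidHom (fun _ : Fin m => SkewPoly θ) j).ker.index = 0 := by
    rw [AddSubgroup.index_ker, AddMonoidHom.range_eq_top.2 (Function.surjective_eval j)]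
    simp
  exact zero_dvd_iff.1 (h0 ▸ AddSubgroup.index_dvd_of_le hle)

theorem vecDeg_diagonal (d : Fin m → SkewPoly θ) (i : Fin m) :
    vecDeg (diagonal d i) = deg (d i) := by
  refine le_antisymm (Finset.sup_le fun j _ => ?_) ?_
  · rcases eq_or_ne i j with rfl | h
    · simp
    · simp [diagonal_apply_ne _ h]
  · simpa using deg_le_vecDeg (diagonal d i) i

theorem leadingPos_diagonal {d : Fin m → SkewPoly θ} {i : Fin m} (hd : d i ≠ 0) :
    leadingPos (diagonal d i) = i := by
  have h0 : diagonal d i ≠ 0 := fun h => hd (by simpa using congrFun h i)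
  obtain ⟨j, hj, hjd, -⟩ := exists_leadingPos_eq h0
  rcases eq_or_ne i j with rfl | h
  · exact hj
  · rw [vecDeg_diagonal, diagonal_apply_ne _ h, deg_zero, eq_comm, deg_eq_bot] at hjd
    exact (hd hjd).elim

theorem isWeakPopov_diagonal {d : Fin m → SkewPoly θ} (hd : ∀ i, d i ≠ 0) :
    IsWeakPopov (diagonal d) := fun i j _ _ h => by
  rw [leadingPos_diagonal (hd i), leadingPos_diagonal (hd j)] at h
  exact WithBot.coe_injective h

theorem diagonal_row_ne_zero {d : Fin m → SkewPoly θ} (hd : ∀ i, d i ≠ 0) (i : Fin m) :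
    diagonal d i ≠ 0 := fun h => hd i (by simpa using congrFun h i)

theorem rowGroup_index_of_isUnit {U : Matrix (Fin m) (Fin m) (SkewPoly θ)} (hU : IsUnit U) :
    (rowGroup U).index = 1 := by
  rw [AddSubgroup.index_eq_one, rowGroup, AddMonoidHom.range_eq_top]
  intro v
  obtain ⟨u, rfl⟩ := hU
  exact ⟨v ᵥ* ↑u⁻¹, by simp⟩

theorem vecMul_injective_of_isUnit_matrix {U : Matrix (Fin m) (Fin m) (SkewPoly θ)} (hU : IsUnit U) :
    Function.Injective (· ᵥ* U) := by
  obtain ⟨u, rfl⟩ := hU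
  exact Function.LeftInverse.injective (g := (· ᵥ* ↑u⁻¹)) fun v => by simp

theorem rowGroup_index_diagonal [Finite F] (d : Fin m → SkewPoly θ) :
    (rowGroup (diagonal d)).index = powBot (Nat.card F) (∑ i, deg (d i)) := by
  by_cases hd : ∀ i, d i ≠ 0
  · obtain ⟨e, he⟩ := exists_vecDeg_row_eq (diagonal_row_ne_zero hd)
    rw [(isWeakPopov_diagonal hd).rowGroup_index_eq (diagonal_row_ne_zero hd) he,
      ← powBot_natCast, ← matDeg_eq he, matDeg]
    simp only [vecDeg_diagonal]
  · push Not at hd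
    obtain ⟨j, hj⟩ := hd
    rw [powBot_sum, prod_eq_zero (mem_univ j) (by simp [hj])]
    refine rowGroup_index_eq_zero_of_column (j := j) fun i => ?_
    rcases eq_or_ne i j with rfl | h
    · simpa
    · exact diagonal_apply_ne _ h

theorem mem_unitsDiagonals (A : Matrix (Fin m) (Fin m) (SkewPoly θ)) :
    A ∈ unitsDiagonals (SkewPoly θ) m :=
  unitsDiagonals_eq_top (deg (θ := θ)) (fun a _ hb => exists_deg_sub_mul_lt a hb) m ▸ Submonoid.mem_top A

/-- Only the right factor is decomposed: right multiplication by a generator is injective, or the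
generator is a diagonal matrix with a zero entry and both sides vanish. -/
theorem rowGroup_index_mul (A B : Matrix (Fin m) (Fin m) (SkewPoly θ)) :
    (rowGroup (A * B)).index = (rowGroup A).index * (rowGroup B).index := by
  induction mem_unitsDiagonals B using Submonoid.closure_induction generalizing A with
  | mem B hB =>
    rcases hB with hU | ⟨d, rfl⟩
    · exact rowGroup_index_mul_of_injective A (vecMul_injective_of_isUnit_matrix hU)
    · by_cases hd : ∀ i, d i ≠ 0
      · exact rowGroup_index_mul_of_injective A
          ((isWeakPopov_diagonal hd).vecMul_injective (diagonal_row_ne_zero hd))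
      · push Not at hd
        obtain ⟨j, hj⟩ := hd
        rw [rowGroup_index_eq_zero_of_column (j := j) (V := A * diagonal d) (by simp [hj]),
          rowGroup_index_eq_zero_of_column (j := j) (V := diagonal d), mul_zero]
        intro i
        rcases eq_or_ne i j with rfl | h
        · simpa
        · exact diagonal_apply_ne _ h
  | one => simp [rowGroup_index_of_isUnit isUnit_one]
  | mul B C _ _ ihB ihC => rw [← mul_assoc, ihC, ihB, ihC B, mul_assoc]

theorem exists_rowGroup_index_eq [Finite F] (A : Matrix (Fin m) (Fin m) (SkewPoly θ)) :
    ∃ e, (rowGroup A).index = powBot (Nat.card F) e := by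
  induction mem_unitsDiagonals A using Submonoid.closure_induction with
  | mem B hB =>
    rcases hB with hU | ⟨d, rfl⟩
    · exact ⟨0, by rw [rowGroup_index_of_isUnit hU, powBot_zero]⟩
    · exact ⟨_, rowGroup_index_diagonal d⟩
  | one => exact ⟨0, by rw [rowGroup_index_of_isUnit isUnit_one, powBot_zero]⟩
  | mul B C _ _ ihB ihC =>
    obtain ⟨b, hb⟩ := ihB
    obtain ⟨c, hc⟩ := ihC
    exact ⟨b + c, by rw [rowGroup_index_mul, hb, hc, powBot_add]⟩

/-- By multiplicativity every factor in a decomposition has nonzero index, which excludes diagonal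
factors with a zero entry. -/
theorem vecMul_injective_of_rowGroup_index_ne_zero {A : Matrix (Fin m) (Fin m) (SkewPoly θ)}
    (hA : (rowGroup A).index ≠ 0) : Function.Injective (· ᵥ* A) := by
  induction mem_unitsDiagonals A using Submonoid.closure_induction with
  | mem B hB =>
    rcases hB with hU | ⟨d, rfl⟩
    · exact vecMul_injective_of_isUnit_matrix hU
    · refine IsWeakPopov.vecMul_injective ?_ ?_
      all_goals
        first
        | refine isWeakPopov_diagonal fun j hj => hA ?_
        | refine diagonal_row_ne_zero fun j hj => hA ?_
        refine rowGroup_index_eq_zero_of_column (j := j) fun i => ?_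
        rcases eq_or_ne i j with rfl | h
        · simpa
        · exact diagonal_apply_ne _ h
  | one => exact vecMul_injective_of_isUnit_matrix isUnit_one
  | mul B C _ _ ihB ihC =>
    rw [rowGroup_index_mul, mul_ne_zero_iff] at hA
    have h := (ihC hA.2).comp (ihB hA.1)
    simpa [Function.comp_def] using h

/-- A matrix of full rank has a row module of finite index. -/
theorem rowGroup_index_ne_zero_of_rowRank [Finite F] {V : Matrix (Fin m) (Fin m) (SkewPoly θ)}
    (hV : rowRank V = m) : (rowGroup V).index ≠ 0 := by
  -- The `m` independent elements of the row module are the rows of a product `of C * V`. Counting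
  -- gives that product nonzero index, and multiplicativity passes this to `V`.
  obtain ⟨f, hf⟩ := exists_linearIndependent_of_le_finrank hV.ge
  have hspan (i : Fin m) : ∃ c : Fin m → SkewPoly θ, c ᵥ* V = f i := by
    obtain ⟨c, hc⟩ := (Submodule.mem_span_range_iff_exists_fun _).1 (f i).2
    exact ⟨c, (vecMul_eq_sum c V).trans hc⟩
  choose C hC using hspan
  have hinj : Function.Injective (· ᵥ* (of C * V)) := by
    refine vecMul_injective_iff.2 ?_
    have hrow : (of C * V).row = fun i => (f i : Fin m → SkewPoly θ) := funext hC
    rw [hrow]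
    exact hf.map' (Submodule.subtype _) (Submodule.ker_subtype _)
  obtain ⟨d, hd⟩ := exists_vecDeg_row_eq (row_ne_zero_of_vecMul_injective hinj)
  have h := (rowGroup_index_ne_zero_and_le hd hinj).1
  rw [rowGroup_index_mul] at h
  exact right_ne_zero_of_mul h

/-- The exponent of the index of the row module, as a power of the number of constants. -/
def indexDeg [Finite F] (A : Matrix (Fin m) (Fin m) (SkewPoly θ)) : WithBot ℕ :=
  (exists_rowGroup_index_eq A).choose

theorem powBot_indexDeg [Finite F] (A : Matrix (Fin m) (Fin m) (SkewPoly θ)) :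
    powBot (Nat.card F) (indexDeg A) = (rowGroup A).index :=
  (exists_rowGroup_index_eq A).choose_spec.symm

theorem indexDeg_eq [Finite F] {A : Matrix (Fin m) (Fin m) (SkewPoly θ)} {e : WithBot ℕ}
    (h : (rowGroup A).index = powBot (Nat.card F) e) : indexDeg A = e :=
  powBot_injective Finite.one_lt_card ((powBot_indexDeg A).trans h)

theorem isDetDegree_indexDeg [Finite F] :
    IsDetDegree (indexDeg : Matrix (Fin m) (Fin m) (SkewPoly θ) → WithBot ℕ) where
  map_mul A B := indexDeg_eq <| by
    rw [rowGroup_index_mul, powBot_add, powBot_indexDeg, powBot_indexDeg]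
  map_isUnit U hU := indexDeg_eq <| by rw [rowGroup_index_of_isUnit hU, powBot_zero]
  map_diagonal d := indexDeg_eq (rowGroup_index_diagonal d)

theorem IsDetDegree.unique {D D' : Matrix (Fin m) (Fin m) (SkewPoly θ) → WithBot ℕ}
    (h : IsDetDegree D) (h' : IsDetDegree D') : D = D' := by
  funext A
  induction mem_unitsDiagonals A using Submonoid.closure_induction with
  | mem B hB =>
    rcases hB with hU | ⟨d, rfl⟩
    · rw [h.map_isUnit B hU, h'.map_isUnit B hU]
    · rw [h.map_diagonal, h'.map_diagonal]
  | one => rw [h.map_isUnit 1 isUnit_one, h'.map_isUnit 1 isUnit_one]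
  | mul B C _ _ ihB ihC => rw [h.map_mul, h'.map_mul, ihB, ihC]

theorem degDet_eq_indexDeg [Finite F] :
    (degDet : Matrix (Fin m) (Fin m) (SkewPoly θ) → WithBot ℕ) = indexDeg :=
  (Classical.epsilon_spec (p := fun D => IsDetDegree D)
    ⟨indexDeg, isDetDegree_indexDeg⟩).unique isDetDegree_indexDeg

end SkewPoly

end

theorem mainTheorem6 {F : Type*} [Field F] [Finite F] (θ : RingAut F) (m : ℕ) :
    (∃! D : Matrix (Fin m) (Fin m) (SkewPoly θ) → WithBot ℕ, SkewPoly.IsDetDegree D) ∧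
    (∀ V : Matrix (Fin m) (Fin m) (SkewPoly θ),
      SkewPoly.rowRank V = m → SkewPoly.IsWeakPopov V →
        SkewPoly.degDet V = SkewPoly.matDeg V ∧ SkewPoly.orthDefect V = 0) ∧
    (∀ V : Matrix (Fin m) (Fin m) (SkewPoly θ),
      SkewPoly.rowRank V = m →
        0 ≤ SkewPoly.degDet V ∧ SkewPoly.degDet V ≤ SkewPoly.matDeg V) := by
  refine ⟨⟨SkewPoly.indexDeg, SkewPoly.isDetDegree_indexDeg, fun D hD =>
    hD.unique SkewPoly.isDetDegree_indexDeg⟩, fun V hV hW => ?_, fun V hV => ?_⟩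
  · have hinj := SkewPoly.vecMul_injective_of_rowGroup_index_ne_zero
      (SkewPoly.rowGroup_index_ne_zero_of_rowRank hV)
    have h0 := SkewPoly.row_ne_zero_of_vecMul_injective hinj
    obtain ⟨d, hd⟩ := SkewPoly.exists_vecDeg_row_eq h0
    have h : SkewPoly.degDet V = SkewPoly.matDeg V := by
      rw [SkewPoly.degDet_eq_indexDeg, SkewPoly.matDeg_eq hd]
      exact SkewPoly.indexDeg_eq (hW.rowGroup_index_eq h0 hd)
    exact ⟨h, by rw [SkewPoly.orthDefect, h, sub_self]⟩
  · have hindex := SkewPoly.rowGroup_index_ne_zero_of_rowRank hV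
    have hinj := SkewPoly.vecMul_injective_of_rowGroup_index_ne_zero hindex
    obtain ⟨d, hd⟩ := SkewPoly.exists_vecDeg_row_eq (SkewPoly.row_ne_zero_of_vecMul_injective hinj)
    rw [SkewPoly.degDet_eq_indexDeg, SkewPoly.matDeg_eq hd]
    constructor
    · rw [← SkewPoly.powBot_le_iff (Finite.one_lt_card (α := F)), SkewPoly.powBot_indexDeg,
        SkewPoly.powBot_zero]
      exact Nat.one_le_iff_ne_zero.2 hindex
    · rw [← SkewPoly.powBot_le_iff (Finite.one_lt_card (α := F)), SkewPoly.powBot_indexDeg]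
      exact (SkewPoly.rowGroup_index_ne_zero_and_le hd hinj).2
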